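/- Let $M$ be a connected smooth manifold (Hausdorff, second countable, without boundary) of dimension $n$, and let $E$ be a smooth real vector bundle over $M$ of finite rank $r$. A generalized subbundle $G$ of $E$ is an arbitrary assignment of a linear subspace $G_p\subseteq E_p$ to each $p\in M$ (the dimension of $G_p$ may vary). A smooth section $s$ of $E$ over an open set $U\subseteq M$ is a section of $G$ if $s(q)\in G_q$ for all $q\in U$. Assume that $G$ is smooth: for every $p\in M$ there are finitely many smooth sections $s_1,\dots,s_k$ of $G$, each defined on an open set containing $p$, such that $G_p=\operatorname{span}\{s_1(p),\dots,s_k(p)\}$. Then $G$ is globally finitely generated: there are finitely many smooth sections $s_1,\dots,s_k$ of $G$ over all of $M$ such that $G_p=\operatorname{span}\{s_1(p),\dots,s_k(p)\}$ for every $p\in M$. Moreover, there is an $m\le r(n+1)$ such that $E$ is isomorphic to a smooth subbundle of the trivial bundle $M\times\mathbb{R}^m$; and for every $m$ for which $E$ is isomorphic to such a subbundle, with $\operatorname{maxdim}(G)=\max_{p\in M}\dim G_p$, there are global smooth sections $s_{d,i}$ of $G$, $1\le d\le\operatorname{maxdim}(G)$, $1\le i\le m$ (some possibly zero), such that for each $d$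 the $m$ sections $s_{d,1},\dots,s_{d,m}$ span $G_p$ at every point $p$ with $\dim G_p=d$, and such that all these $m\cdot\operatorname{maxdim}(G)$ sections together span $G_p$ at every point $p\in M$. -/

import Mathlib

open scoped Manifold ContDiff Bundle

section GeneralizedSubbundles

variable {n : ℕ} {M : Type*} [TopologicalSpace M] [ChartedSpace (EuclideanSpace ℝ (Fin n)) M]
  {F : Type*} [NormedAddCommGroup F] [NormedSpace ℝ F]
  {E : M → Type*} [TopologicalSpace (Bundle.TotalSpace F E)]
  [∀ p, AddCommGroup (E p)] [∀ p, Module ℝ (E p)] [∀ p, TopologicalSpace (E p)] [FiberBundle F E]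

/-- A generalized subbundle of `E`: an arbitrary choice of a linear subspace `G p` of the fiber
`E p` for each point `p`. -/
abbrev GeneralizedSubbundle {M : Type*} (E : M → Type*)
    [∀ p, AddCommGroup (E p)] [∀ p, Module ℝ (E p)] :=
  ∀ p : M, Submodule ℝ (E p)

variable (n F) in
/-- `s` restricts to a smooth section of the vector bundle `E` over the set `U`
(used for open `U`; the values of `s` outside `U` are irrelevant). -/
def IsSmoothSectionOn (s : ∀ p, E p) (U : Set M) : Prop :=
  ContMDiffOn (𝓡 n) ((𝓡 n).prod 𝓘(ℝ, F)) ∞ (fun p => Bundle.TotalSpace.mk' F p (s p)) U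

namespace GeneralizedSubbundle

variable (n F) in
/-- `s` is a smooth section of `E` over `U` which belongs to `G`. -/
def IsSectionOn (G : GeneralizedSubbundle E) (s : ∀ p, E p) (U : Set M) : Prop :=
  IsSmoothSectionOn n F s U ∧ ∀ p ∈ U, s p ∈ G p

variable (n F) in
/-- A generalized subbundle `G` is smooth if for each point `p` there are finitely many local
smooth sections of `G`, each defined on an open set containing `p`, whose values at `p`
span `G p`. -/
def IsSmooth (G : GeneralizedSubbundle E) : Prop :=
  ∀ p : M, ∃ (k : ℕ) (U : Fin k → Set M) (s : Fin k → ∀ q, E q),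
    (∀ i, IsOpen (U i) ∧ p ∈ U i ∧ G.IsSectionOn n F (s i) (U i)) ∧
    G p = Submodule.span ℝ (Set.range fun i => s i p)

variable (n F) in
/-- The family `s` of smooth sections of `G` over `U` generates `G` over `U`: its values span
`G p` at each `p ∈ U`. -/
def GeneratesOver (G : GeneralizedSubbundle E) {ι : Type*} (s : ι → ∀ p, E p) (U : Set M) : Prop :=
  (∀ i, G.IsSectionOn n F (s i) U) ∧
    ∀ p ∈ U, G p = Submodule.span ℝ (Set.range fun i => s i p)

variable (n F) in
/-- `G` is finitely generated over `U`. -/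
def FinitelyGeneratedOver (G : GeneralizedSubbundle E) (U : Set M) : Prop :=
  ∃ (k : ℕ) (s : Fin k → ∀ p, E p), G.GeneratesOver n F s U

variable (n F) in
/-- `G` is globally finitely generated. -/
def GloballyFinitelyGenerated (G : GeneralizedSubbundle E) : Prop :=
  G.FinitelyGeneratedOver n F Set.univ

/-- The maximum dimension of the fibers of `G`. (In a vector bundle of finite rank the dimensions
are bounded by the rank, so over a nonempty base the supremum is a maximum.) -/
noncomputable def maxdim (G : GeneralizedSubbundle E) : ℕ :=
  ⨆ p : M, Module.finrank ℝ (G p)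

/-- The set of points at which the fiber of `G` has dimension `d`. -/
def stratum (G : GeneralizedSubbundle E) (d : ℕ) : Set M :=
  {p | Module.finrank ℝ (G p) = d}

end GeneralizedSubbundle

variable (n F E) in
/-- The vector bundle `E` is isomorphic to a (smooth) subbundle of the trivial bundle `M × ℝ^m`:
there is a smooth map `E → M × ℝ^m` over the identity of `M` which is linear and injective on each
fiber (its image is then a subbundle, to which `E` is isomorphic). -/
def EmbedsInTrivialBundle (m : ℕ) : Prop :=
  ∃ Φ : ∀ p : M, E p →ₗ[ℝ] EuclideanSpace ℝ (Fin m),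
    (∀ p, Function.Injective (Φ p)) ∧
    ContMDiff ((𝓡 n).prod 𝓘(ℝ, F)) ((𝓡 n).prod 𝓘(ℝ, EuclideanSpace ℝ (Fin m))) ∞
      (fun v : Bundle.TotalSpace F E => ((v.1, Φ v.1 v.2) : M × EuclideanSpace ℝ (Fin m)))

end GeneralizedSubbundles

/-!
Both assertions are proved by perturbation and orthogonal projection; no covering dimension of `M`
is used.

*Embedding.* Let `r` be the rank of `E`. Take a locally finite sequence of cutoff functions `χ i`
supported in charts over which `E` is trivial, by `e i` say, and start from the bundle map `Φ 0 = 0`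
to `M × W`. Put `Φ (i + 1) = Φ i + χ i • A i ∘ e i` with a linear map `A i : F → W` such that
`Φ (i + 1)` is injective on the fibers over all points with `χ i ≠ 0`. The linear maps that are not
allowed are those which agree, on some nonzero vector, with some member of an `n`-parameter family
of linear maps; they form a set of Hausdorff dimension less than `dim Hom (F, W)` as soon as
`n + r ≤ dim W` (`exists_linearMap_forall_apply_ne`). Near each point the sequence is eventually
constant, and at each point the last modification that takes place makes `Φ` injective, so the limit
is an embedding (`exists_isSmoothBundleMap_injective`). For `r > 0` one has `n + r ≤ r (n + 1)`.

*Generators.* Let `Φ` embed `E` in `M × ℝ^m`. On the stratum `S` where `G` has dimension `d`, the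
orthogonal projection to `Φ (G p)` maps the standard basis to `m` vectors spanning `Φ (G p)`. Near a
point of `S`, choose `d` smooth sections of `G` forming a basis there, and project to their span
instead. Multiplied by the Gram determinant `c` of the sections, this projection is polynomial in
the sections, its values lie in `Φ G`, and on all of `S` it is `c` times the projection to
`Φ (G p)`: where the `d` sections are dependent, both sides vanish (`sum_gramCramer_smul`). These
conditions on the pair of `c` and the projected vectors define a closed convex cone at each point of
`M`. Hence countably many such pairs with `c > 0` somewhere on `S` can be combined, by a convergent
series with small coefficients, into one with `c > 0` everywhere on `S`
(`exists_contMDiff_mem_cone_forall_pos`). Pulling the vectors back by `Φ` gives `m` smooth sections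
of `G` which span it over `S`; the strata with `0 < d` then contribute `m` sections each.
-/

open scoped Topology

/-! ### Generic linear maps -/

theorem ContDiffOn.dimH_image_le_finrank_of_isOpen {V W : Type*} [NormedAddCommGroup V]
    [NormedSpace ℝ V] [FiniteDimensional ℝ V] [NormedAddCommGroup W] [NormedSpace ℝ W]
    {f : V → W} {s : Set V} (hs : IsOpen s) (hf : ContDiffOn ℝ 1 f s) :
    dimH (f '' s) ≤ Module.finrank ℝ V := by
  refine (dimH_image_le_of_locally_lipschitzOn fun x hx => ?_).trans
    ((dimH_mono (Set.subset_univ s)).trans_eq (Real.dimH_univ_eq_finrank V))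
  obtain ⟨K, t, ht, h⟩ := (hf.contDiffAt (hs.mem_nhds hx)).exists_lipschitzOnWith
  exact ⟨K, t, mem_nhdsWithin_of_mem_nhds ht, h⟩

theorem sum_smul_eq_smul_add_sum_ne {ι X : Type*} [Fintype ι] [DecidableEq ι] [AddCommGroup X]
    [Module ℝ X] (c : ι → ℝ) {j : ι} (hj : c j ≠ 0) (y : ι → X) :
    ∑ k, c k • y k = c j • (y j + ∑ l : {l // l ≠ j}, ((c j)⁻¹ * c l) • y l) := by
  rw [Fintype.sum_eq_add_sum_subtype_ne _ j, smul_add, Finset.smul_sum]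
  congr 1
  refine Finset.sum_congr rfl fun l _ => ?_
  rw [smul_smul, ← mul_assoc, mul_inv_cancel₀ hj, one_mul]

/-- A generic linear map `A : F → W` differs, on all nonzero vectors, from every member of a family
of homogeneous maps `g (x, ·)` with parameter `x` in an open subset of `V`, provided that
`dim V + dim F ≤ dim W` or `F = 0`. In fact, the maps `A` violating this lie in finitely many smooth images of
spaces of dimension less than that of `F →ₗ W`, one for each coordinate `j` of `F`: if
`A v = g (x, v)` with `v j = 1`, then `A` is determined by `x`, by the other coordinates of `v` and
by the values of `A` on the other basis vectors. -/
theorem exists_linearMap_forall_apply_ne {V F W : Type*} [NormedAddCommGroup V] [NormedSpace ℝ V]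
    [FiniteDimensional ℝ V] [NormedAddCommGroup F] [NormedSpace ℝ F] [FiniteDimensional ℝ F]
    [NormedAddCommGroup W] [NormedSpace ℝ W] [FiniteDimensional ℝ W]
    {g : V × F → W} {Ω : Set V} (hΩ : IsOpen Ω) (hg : ContDiffOn ℝ 1 g (Ω ×ˢ Set.univ))
    (hsmul : ∀ x ∈ Ω, ∀ (c : ℝ) (v : F), g (x, c • v) = c • g (x, v))
    (hdim : 0 < Module.finrank ℝ F →
      Module.finrank ℝ V + Module.finrank ℝ F ≤ Module.finrank ℝ W) :
    ∃ A : F →ₗ[ℝ] W, ∀ x ∈ Ω, ∀ v : F, v ≠ 0 → A v ≠ g (x, v) := by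
  classical
  let b := Module.finBasis ℝ F
  -- The values on the basis of the linear map with `A v = g (x, v)`, where `v j = 1`.
  let h : ∀ j : Fin (Module.finrank ℝ F),
      V × ({k // k ≠ j} → ℝ) × ({k // k ≠ j} → W) → (Fin (Module.finrank ℝ F) → W) :=
    fun j z k => if hk : k = j
      then g (z.1, b j + ∑ l, z.2.1 l • b l) - ∑ l, z.2.1 l • z.2.2 l else z.2.2 ⟨k, hk⟩
  have hh : ∀ j, dimH (h j '' (Ω ×ˢ Set.univ)) <
      Module.finrank ℝ (Fin (Module.finrank ℝ F) → W) := by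
    intro j
    have hpos : 0 < Module.finrank ℝ F := j.pos
    have hcd : ContDiffOn ℝ 1 (h j) (Ω ×ˢ Set.univ) := by
      refine contDiffOn_pi.2 fun k => ?_
      by_cases hk : k = j
      · simp only [h, hk, dite_true]
        refine ContDiffOn.sub (hg.comp (ContDiff.contDiffOn (by fun_prop)) ?_)
          (ContDiff.contDiffOn (by fun_prop))
        rintro z ⟨hz, -⟩
        exact ⟨hz, trivial⟩
      · simp only [h, hk, dite_false]
        exact ContDiff.contDiffOn (by fun_prop)
    refine (hcd.dimH_image_le_finrank_of_isOpen (hΩ.prod isOpen_univ)).trans_lt ?_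
    have hc : Fintype.card {k : Fin (Module.finrank ℝ F) // k ≠ j} = Module.finrank ℝ F - 1 := by
      rw [Fintype.card_subtype_compl]; simp
    rw [Module.finrank_prod, Module.finrank_prod, Module.finrank_pi, Module.finrank_pi_fintype,
      Module.finrank_pi_fintype]
    simp only [Finset.sum_const, Finset.card_univ, hc, Fintype.card_fin, smul_eq_mul]
    have := hdim hpos
    obtain ⟨r, hr⟩ := Nat.exists_eq_add_of_lt hpos
    simp only [zero_add] at hr
    rw [hr] at this ⊢
    norm_cast
    simp only [Nat.add_sub_cancel]
    linarith [add_mul r 1 (Module.finrank ℝ W)]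
  have hU : dimH (⋃ j, h j '' (Ω ×ˢ Set.univ)) <
      Module.finrank ℝ (Fin (Module.finrank ℝ F) → W) ∨ Module.finrank ℝ F = 0 := by
    rcases Nat.eq_zero_or_pos (Module.finrank ℝ F) with h0 | h0
    · exact Or.inr h0
    · left
      have : Nonempty (Fin (Module.finrank ℝ F)) := ⟨⟨0, h0⟩⟩
      rw [dimH_iUnion]
      obtain ⟨j, hj⟩ := exists_eq_ciSup_of_finite (f := fun j => dimH (h j '' (Ω ×ˢ Set.univ)))
      rw [← hj]
      exact hh j
  rcases hU with hU | h0
  · obtain ⟨a, ha⟩ := (dense_compl_of_dimH_lt_finrank hU).nonempty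
    refine ⟨b.constr ℝ a, fun x hx v hv hA => ha ?_⟩
    obtain ⟨j, hj⟩ : ∃ j, b.repr v j ≠ 0 := by
      by_contra! hcon
      exact hv (b.repr.map_eq_zero_iff.1 (Finsupp.ext hcon))
    let t := b.repr v j
    let u : {k // k ≠ j} → ℝ := fun l => t⁻¹ * b.repr v l
    have hv' : v = t • (b j + ∑ l : {k // k ≠ j}, u l • b l) := by
      rw [← sum_smul_eq_smul_add_sum_ne _ hj, b.sum_repr]
    have hA' : a j + ∑ l : {k // k ≠ j}, u l • a l = g (x, b j + ∑ l : {k // k ≠ j}, u l • b l) := by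
      have h1 : b.constr ℝ a v = t • (a j + ∑ l : {k // k ≠ j}, u l • a l) := by
        rw [← sum_smul_eq_smul_add_sum_ne _ hj, b.constr_apply_fintype ℝ]; rfl
      rw [hv', hsmul x hx, ← hv', h1] at hA
      exact smul_right_injective W hj hA
    refine Set.mem_iUnion.2 ⟨j, ⟨(x, u, fun l => a l), ⟨hx, trivial⟩, ?_⟩⟩
    ext k
    by_cases hk : k = j
    · subst hk
      simp only [h, dite_true, ← hA', add_sub_cancel_right]
    · simp [h, hk]
  · refine ⟨0, fun x _ v hv => (hv ?_).elim⟩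
    have := Module.finrank_zero_iff.1 h0
    exact Subsingleton.elim _ _

/-! ### Embedding a vector bundle in a trivial bundle -/

section Embedding

variable {n : ℕ} {M : Type*} [TopologicalSpace M] [ChartedSpace (EuclideanSpace ℝ (Fin n)) M]
  [IsManifold (𝓡 n) ∞ M]
  {F : Type*} [NormedAddCommGroup F] [NormedSpace ℝ F] [FiniteDimensional ℝ F]
  {E : M → Type*} [TopologicalSpace (Bundle.TotalSpace F E)]
  [∀ p, AddCommGroup (E p)] [∀ p, Module ℝ (E p)] [∀ p, TopologicalSpace (E p)]
  [FiberBundle F E] [VectorBundle ℝ F E] [ContMDiffVectorBundle ∞ F E (𝓡 n)]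
  {W : Type*} [NormedAddCommGroup W] [NormedSpace ℝ W]

variable (n F) in
/-- A fiberwise linear map `Φ` from `E` to the trivial bundle `M × W` is smooth: its second
component is a smooth function on the total space. -/
def IsSmoothBundleMap (Φ : ∀ p, E p →ₗ[ℝ] W) : Prop :=
  ContMDiff ((𝓡 n).prod 𝓘(ℝ, F)) 𝓘(ℝ, W) ∞ fun v : Bundle.TotalSpace F E => Φ v.1 v.2

/-- A smooth bundle map can be modified where the cutoff function `χ` does not vanish, by adding to
it `χ` times a constant linear map in a local trivialization, such that it becomes injective
there. -/
theorem IsSmoothBundleMap.exists_injective_of_ne_zero [FiniteDimensional ℝ W]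
    (hdim : 0 < Module.finrank ℝ F → n + Module.finrank ℝ F ≤ Module.finrank ℝ W)
    {Φ : ∀ p, E p →ₗ[ℝ] W} (hΦ : IsSmoothBundleMap n F Φ) (x₀ : M) {χ : M → ℝ}
    (hχ : ContMDiff (𝓡 n) 𝓘(ℝ, ℝ) ∞ χ) (hχs : tsupport χ ⊆
      (chartAt (EuclideanSpace ℝ (Fin n)) x₀).source ∩ (trivializationAt F E x₀).baseSet) :
    ∃ Φ' : ∀ p, E p →ₗ[ℝ] W, IsSmoothBundleMap n F Φ' ∧
      ∀ p, (χ p = 0 → Φ' p = Φ p) ∧ (χ p ≠ 0 → Function.Injective (Φ' p)) := by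
  set c := chartAt (EuclideanSpace ℝ (Fin n)) x₀ with hc
  set e := trivializationAt F E x₀ with he
  let Ω : Set (EuclideanSpace ℝ (Fin n)) := c.target ∩ c.symm ⁻¹' (Function.support χ)
  have hΩ : IsOpen Ω := c.symm.isOpen_inter_preimage hχ.continuous.isOpen_support
  have hbase : ∀ x ∈ Ω, c.symm x ∈ e.baseSet := fun x hx => (hχs (subset_closure hx.2)).2
  -- `Φ p + χ p • A ∘ e p` kills `v` exactly if `A` agrees on `e p v` with this map over `p`.
  let g : EuclideanSpace ℝ (Fin n) × F → W := fun z =>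
    -((χ (c.symm z.1))⁻¹ • Φ (c.symm z.1) (e.symmₗ ℝ (c.symm z.1) z.2))
  have hcs : ContMDiffOn ((𝓡 n).prod 𝓘(ℝ, F)) (𝓡 n) ∞ (fun z : EuclideanSpace ℝ (Fin n) × F =>
      c.symm z.1) (Ω ×ˢ Set.univ) :=
    (contMDiffOn_chart_symm (I := 𝓡 n) (x := x₀)).comp contMDiffOn_fst fun z hz => hz.1.1
  have hg : ContDiffOn ℝ 1 g (Ω ×ˢ Set.univ) := by
    refine ContDiffOn.of_le (n := ∞) ?_ (mod_cast le_top)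
    rw [← contMDiffOn_iff_contDiffOn, modelWithCornersSelf_prod, ← chartedSpaceSelf_prod]
    have h1 : ContMDiffOn ((𝓡 n).prod 𝓘(ℝ, F)) ((𝓡 n).prod 𝓘(ℝ, F)) ∞
        (fun z : EuclideanSpace ℝ (Fin n) × F =>
          e.toOpenPartialHomeomorph.symm (c.symm z.1, z.2)) (Ω ×ˢ Set.univ) :=
      (e.contMDiffOn_symm (IB := 𝓡 n)).comp (hcs.prodMk contMDiffOn_snd) fun z hz =>
        e.mem_target.2 (hbase _ hz.1)
    have h2 := hΦ.comp_contMDiffOn h1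
    have h3 : ContMDiffOn ((𝓡 n).prod 𝓘(ℝ, F)) 𝓘(ℝ, ℝ) ∞
        (fun z : EuclideanSpace ℝ (Fin n) × F => (χ (c.symm z.1))⁻¹) (Ω ×ˢ Set.univ) :=
      (hχ.comp_contMDiffOn hcs).inv₀ fun z hz => hz.1.2
    refine ((h3.smul h2).neg).congr fun z hz => ?_
    have h4 := e.mk_symm (hbase _ hz.1) z.2
    simp only [g, Pi.smul_apply', Function.comp_apply]
    rw [← h4, e.symmₗ_apply (hbase _ hz.1)]
  obtain ⟨A, hA⟩ := exists_linearMap_forall_apply_ne hΩ hg (fun x _ a v => by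
    simp only [g, map_smul, smul_neg, smul_comm a])
    (by simpa using hdim)
  refine ⟨fun p => Φ p + χ p • A.comp (e.linearMapAt ℝ p), ?_, fun p =>
    ⟨fun h => by simp [h], fun h => ?_⟩⟩
  · refine hΦ.add (contMDiff_of_tsupport fun v hv => ?_)
    have hv' : v.1 ∈ tsupport χ := by
      refine closure_minimal (t := Bundle.TotalSpace.proj ⁻¹' tsupport χ) (fun w hw => ?_)
        ((isClosed_tsupport χ).preimage (FiberBundle.continuous_proj F E)) hv
      exact subset_closure (left_ne_zero_of_smul hw)
    have hsrc : v ∈ e.source := e.mem_source.2 (hχs hv').2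
    have hA' : ContMDiffAt ((𝓡 n).prod 𝓘(ℝ, F)) 𝓘(ℝ, W) ∞
        (fun w : Bundle.TotalSpace F E => A.toContinuousLinearMap (e w).2) v :=
      A.toContinuousLinearMap.contMDiff.contMDiffAt.comp v
        ((e.contMDiffOn (IB := 𝓡 n) (n := ∞)).contMDiffAt (e.open_source.mem_nhds hsrc)).snd
    refine (((hχ.contMDiffAt.comp v (Bundle.contMDiffAt_proj E)).smul hA').congr_of_eventuallyEq ?_)
    filter_upwards [e.open_source.mem_nhds hsrc] with w hw
    simp [e.coe_linearMapAt_of_mem (R := ℝ) (e.mem_source.1 hw)]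
  · rw [← LinearMap.ker_eq_bot, LinearMap.ker_eq_bot']
    intro v hv
    have hp : p ∈ c.source ∩ e.baseSet := hχs (subset_closure h)
    by_contra hv0
    have hΩp : c p ∈ Ω := ⟨c.map_source hp.1, by simpa [c.left_inv hp.1] using h⟩
    have hsymm : e.symmₗ ℝ p (e.linearMapAt ℝ p v) = v := e.symmₗ_linearMapAt hp.2 v
    refine hA (c p) hΩp (e.linearMapAt ℝ p v) (fun h0 => hv0 ?_) ?_
    · rw [← hsymm, h0, map_zero]
    · have hv' : χ p • A (e.linearMapAt ℝ p v) = -Φ p v := by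
        rw [eq_neg_iff_add_eq_zero, add_comm]
        exact hv
      have hΦp : ∀ q, q = p → ∀ a, Φ q (e.symmₗ ℝ q a) = Φ p (e.symmₗ ℝ p a) := by
        rintro _ rfl _
        rfl
      simp only [g]
      rw [hΦp _ (c.left_inv hp.1), c.left_inv hp.1, hsymm, ← smul_neg, ← hv', smul_smul,
        inv_mul_cancel₀ h, one_smul]

/-- A smooth vector bundle of rank `r` over a manifold of dimension `n` embeds in every trivial
bundle whose fiber has dimension at least `n + r` (or any dimension if `r = 0`). -/
theorem exists_isSmoothBundleMap_injective [T2Space M] [SecondCountableTopology M] [Nonempty M]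
    [FiniteDimensional ℝ W]
    (hdim : 0 < Module.finrank ℝ F → n + Module.finrank ℝ F ≤ Module.finrank ℝ W) :
    ∃ Φ : ∀ p, E p →ₗ[ℝ] W, IsSmoothBundleMap n F Φ ∧ ∀ p, Function.Injective (Φ p) := by
  have := Manifold.locallyCompact_of_finiteDimensional (M := M) (𝓡 n)
  let U : M → Set M := fun x =>
    (chartAt (EuclideanSpace ℝ (Fin n)) x).source ∩ (trivializationAt F E x).baseSet
  have hUo : ∀ x, IsOpen (U x) := fun x =>
    (chartAt (EuclideanSpace ℝ (Fin n)) x).open_source.inter (trivializationAt F E x).open_baseSet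
  obtain ⟨T, hTc, hT⟩ := TopologicalSpace.countable_cover_nhds (f := U) fun x =>
    (hUo x).mem_nhds ⟨mem_chart_source _ x, FiberBundle.mem_baseSet_trivializationAt' x⟩
  obtain ⟨t, ht⟩ := hTc.exists_eq_range (by
    obtain ⟨x, hx, -⟩ := Set.mem_iUnion₂.1 (hT.ge (Set.mem_univ (Classical.arbitrary M)))
    exact ⟨x, hx⟩)
  obtain ⟨ρ, hρ⟩ := SmoothPartitionOfUnity.exists_isSubordinate (𝓡 n) isClosed_univ
    (fun i : ℕ => U (t i)) (fun i => hUo _) (by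
      rw [← hT, ht, Set.biUnion_range])
  have hstep : ∀ (i : ℕ) (Φ : {Φ : ∀ p, E p →ₗ[ℝ] W // IsSmoothBundleMap n F Φ}),
      ∃ Φ' : {Φ : ∀ p, E p →ₗ[ℝ] W // IsSmoothBundleMap n F Φ}, ∀ p,
        (ρ i p = 0 → Φ'.1 p = Φ.1 p) ∧ (ρ i p ≠ 0 → Function.Injective (Φ'.1 p)) := fun i Φ => by
    obtain ⟨Φ', h1, h2⟩ :=
      Φ.2.exists_injective_of_ne_zero hdim (t i) (ρ i).contMDiff (hρ i)
    exact ⟨⟨Φ', h1⟩, h2⟩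
  choose next hnext using hstep
  let Ψ : ℕ → {Φ : ∀ p, E p →ₗ[ℝ] W // IsSmoothBundleMap n F Φ} := fun i =>
    Nat.rec ⟨fun _ => 0, contMDiff_const⟩ (fun i Φ => next i Φ) i
  have hΨ : ∀ i p, (ρ i p = 0 → (Ψ (i + 1)).1 p = (Ψ i).1 p) ∧
      (ρ i p ≠ 0 → Function.Injective ((Ψ (i + 1)).1 p)) := fun i => hnext i (Ψ i)
  have hconst : ∀ p N, (∀ i, N ≤ i → ρ i p = 0) → ∀ i, N ≤ i → (Ψ i).1 p = (Ψ N).1 p := by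
    intro p N hN i hi
    induction i, hi using Nat.le_induction with
    | base => rfl
    | succ i hi ih => rw [((hΨ i p).1 (hN i hi)), ih]
  -- Near each point only finitely many functions of the partition of unity do not vanish.
  have hloc : ∀ p, ∃ N, ∃ V ∈ 𝓝 p, ∀ q ∈ V, ∀ i, N ≤ i → ρ i q = 0 := by
    intro p
    obtain ⟨V, hV, hfin⟩ := ρ.locallyFinite p
    obtain ⟨N, hN⟩ := hfin.bddAbove
    refine ⟨N + 1, V, hV, fun q hq i hi => by_contra fun hne => ?_⟩
    have := hN (show i ∈ _ from ⟨q, hne, hq⟩)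
    omega
  choose N V hV hNV using hloc
  have hlim : ∀ p, ∀ q ∈ V p, (Ψ (N q)).1 q = (Ψ (N p)).1 q := by
    intro p q hq
    rw [← hconst q (N p) (hNV p q hq) _ (le_max_left (N p) (N q)),
      hconst q (N q) (hNV q q (mem_of_mem_nhds (hV q))) _ (le_max_right (N p) (N q))]
  refine ⟨fun p => (Ψ (N p)).1 p, fun v => ?_, fun p => ?_⟩
  · refine ((Ψ (N v.1)).2 v).congr_of_eventuallyEq ?_
    filter_upwards [(FiberBundle.continuous_proj F E).continuousAt.preimage_mem_nhds (hV v.1)]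
      with w hw
    rw [hlim v.1 w.1 hw]
  · -- The last modification at `p` makes the map injective there.
    obtain ⟨i₀, hi₀⟩ := ρ.exists_pos_of_mem (Set.mem_univ p)
    have hex : ∃ m, ∀ i, m ≤ i → ρ i p = 0 := ⟨N p, hNV p p (mem_of_mem_nhds (hV p))⟩
    classical
    have hm := Nat.find_spec hex
    have hmin := fun k => Nat.find_min hex (m := k)
    set m := Nat.find hex
    have hmpos : m ≠ 0 := fun h0 => hi₀.ne' (hm i₀ (by omega))
    obtain ⟨k, hk⟩ := Nat.exists_eq_succ_of_ne_zero hmpos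
    have hne : ρ k p ≠ 0 := fun h0 => hmin k (by omega) fun i hi => by
      rcases hi.eq_or_lt with rfl | hlt
      · exact h0
      · exact hm i (by omega)
    have hmN : m ≤ N p := Nat.find_min' hex (hNV p p (mem_of_mem_nhds (hV p)))
    change Function.Injective ((Ψ (N p)).1 p)
    rw [hconst p m hm (N p) hmN, hk]
    exact (hΨ k p).2 hne

end Embedding

/-! ### Orthogonal projections and Gram determinants -/

theorem contDiff_matrix_det {X κ : Type*} [NormedAddCommGroup X] [NormedSpace ℝ X] [Fintype κ]
    [DecidableEq κ] {A : X → Matrix κ κ ℝ} {N : WithTop ℕ∞}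
    (hA : ∀ i j, ContDiff ℝ N fun x => A x i j) : ContDiff ℝ N fun x => (A x).det := by
  simp only [Matrix.det_apply']
  exact ContDiff.sum fun σ _ => contDiff_const.mul (contDiff_prod fun i _ => hA _ _)

section Gram

variable {κ W : Type*} [Fintype κ] [DecidableEq κ] [NormedAddCommGroup W] [InnerProductSpace ℝ W]

/-- The coefficients of the orthogonal projection of `z` to the span of the vectors `y k`,
multiplied by the Gram determinant of `y`. By Cramer's rule they are polynomials in the inner
products of the vectors, also where `y` is linearly dependent. -/
noncomputable def gramCramer (y : κ → W) (z : W) : κ → ℝ :=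
  (Matrix.gram ℝ y).cramer fun k => inner ℝ (y k) z

/-- Both sides lie in the span of `y` and have the same inner products with each `y l`. If `y` is
linearly dependent, then both sides are zero. -/
theorem sum_gramCramer_smul [FiniteDimensional ℝ W] (y : κ → W) (z : W) :
    ∑ k, gramCramer y z k • y k =
      (Matrix.gram ℝ y).det • (Submodule.span ℝ (Set.range y)).starProjection z := by
  set P := Submodule.span ℝ (Set.range y)
  rw [← map_smul]
  refine (Submodule.eq_starProjection_of_mem_of_inner_eq_zero ?_ ?_).symm
  · exact Submodule.sum_mem _ fun k _ =>
      Submodule.smul_mem _ _ (Submodule.subset_span ⟨k, rfl⟩)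
  · intro w hw
    suffices h : Submodule.span ℝ (Set.range y) ≤
        (ℝ ∙ ((Matrix.gram ℝ y).det • z - ∑ k, gramCramer y z k • y k))ᗮ from
      Submodule.mem_orthogonal_singleton_iff_inner_right.1 (h hw)
    rw [Submodule.span_le]
    rintro _ ⟨l, rfl⟩
    have := congrFun (Matrix.mulVec_cramer (Matrix.gram ℝ y) fun k => inner ℝ (y k) z) l
    simp only [Matrix.mulVec, dotProduct, Matrix.gram_apply, Pi.smul_apply, smul_eq_mul] at this
    rw [SetLike.mem_coe, Submodule.mem_orthogonal_singleton_iff_inner_left, inner_sub_right,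
      inner_smul_right, inner_sum, ← this, sub_eq_zero]
    exact Finset.sum_congr rfl fun k _ => by rw [inner_smul_right, mul_comm]; rfl

theorem contDiff_gramCramer {N : WithTop ℕ∞} (k : κ) :
    ContDiff ℝ N fun x : (κ → W) × W => gramCramer x.1 x.2 k := by
  simp only [gramCramer, Matrix.cramer_apply]
  refine contDiff_matrix_det fun i j => ?_
  simp only [Matrix.updateCol_apply, Matrix.gram_apply]
  split_ifs <;> exact ContDiff.inner ℝ (by fun_prop) (by fun_prop)

theorem contDiff_det_gram {N : WithTop ℕ∞} :
    ContDiff ℝ N fun y : κ → W => (Matrix.gram ℝ y).det := by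
  refine contDiff_matrix_det fun i j => ?_
  simp only [Matrix.gram_apply]
  exact ContDiff.inner ℝ (by fun_prop) (by fun_prop)

end Gram

/-! ### Smooth series with values in cones -/

section SmoothSeries

/-- Countably many smooth compactly supported functions can be rescaled by positive factors so that
their series converges to a smooth function. -/
theorem exists_pos_contDiff_tsum_smul {V H : Type*} [NormedAddCommGroup V] [NormedSpace ℝ V]
    [NormedAddCommGroup H] [NormedSpace ℝ H] [CompleteSpace H] (w : ℕ → V → H)
    (hw : ∀ k, ContDiff ℝ ∞ (w k)) (hc : ∀ k, HasCompactSupport (w k)) :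
    ∃ r : ℕ → ℝ, (∀ k, 0 < r k) ∧ (∀ x, Summable fun k => r k • w k x) ∧
      ContDiff ℝ ∞ fun x => ∑' k, r k • w k x := by
  have hb : ∀ k : ℕ, ∃ C : ℝ, 0 < C ∧ ∀ i ≤ k, ∀ x, ‖iteratedFDeriv ℝ i (w k) x‖ ≤ C := by
    intro k
    have : ∀ i : ℕ, ∃ C : ℝ, ∀ x, ‖iteratedFDeriv ℝ i (w k) x‖ ≤ C := fun i =>
      ((hw k).continuous_iteratedFDeriv (mod_cast le_top)).bounded_above_of_compact_support
        ((hc k).iteratedFDeriv i)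
    choose C hC using this
    refine ⟨∑ i ∈ Finset.range (k + 1), |C i| + 1, by positivity, fun i hi x => ?_⟩
    have := Finset.single_le_sum (f := fun i => |C i|) (fun _ _ => abs_nonneg _)
      (Finset.mem_range.2 (Nat.lt_succ_of_le hi))
    exact (hC i x).trans ((le_abs_self _).trans (this.trans (by linarith)))
  choose C hC0 hC using hb
  have hle : ∀ i k : ℕ, i ≤ k → ∀ x,
      ‖iteratedFDeriv ℝ i (fun x => ((1 / 2) ^ k / C k) • w k x) x‖ ≤ (1 / 2 : ℝ) ^ k := by
    intro i k hik x
    have h := iteratedFDeriv_const_smul_apply (a := ((1 / 2 : ℝ) ^ k / C k)) (x := x) (i := i)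
      ((hw k).of_le (mod_cast le_top)).contDiffAt
    change ‖iteratedFDeriv ℝ i (((1 / 2 : ℝ) ^ k / C k) • w k) x‖ ≤ _
    rw [h, norm_smul, Real.norm_of_nonneg (by have := hC0 k; positivity)]
    calc (1 / 2 : ℝ) ^ k / C k * ‖iteratedFDeriv ℝ i (w k) x‖
        ≤ (1 / 2 : ℝ) ^ k / C k * C k := by
          have := hC0 k
          gcongr
          exact hC k i hik x
      _ = (1 / 2 : ℝ) ^ k := div_mul_cancel₀ _ (hC0 k).ne'
  refine ⟨fun k => (1 / 2) ^ k / C k, fun k => div_pos (by positivity) (hC0 k), fun x => ?_, ?_⟩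
  · refine Summable.of_norm_bounded summable_geometric_two fun k => ?_
    simpa using hle 0 k (Nat.zero_le _) x
  · refine contDiff_tsum_of_eventually (N := ⊤) (v := fun _ k => (1 / 2 : ℝ) ^ k)
      (fun k => (hw k).const_smul _) (fun _ _ => summable_geometric_two) fun i _ => ?_
    rw [Nat.cofinite_eq_atTop]
    filter_upwards [Filter.eventually_ge_atTop i] with k hk x using hle i k hk x

variable {n : ℕ} {M : Type*} [TopologicalSpace M]
  [ChartedSpace (EuclideanSpace ℝ (Fin n)) M] [IsManifold (𝓡 n) ∞ M]

/-- Near each point of a manifold, countably many smooth functions can be rescaled by positive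
functions so that their series converges to a smooth function. -/
theorem exists_contMDiffOn_tsum_smul {H : Type*} [NormedAddCommGroup H] [NormedSpace ℝ H]
    [CompleteSpace H] (u : ℕ → M → H) (hu : ∀ k, ContMDiff (𝓡 n) 𝓘(ℝ, H) ∞ (u k)) (x₀ : M) :
    ∃ U ∈ 𝓝 x₀, ∃ a : ℕ → M → ℝ, (∀ k, ∀ x ∈ U, 0 < a k x) ∧
      (∀ x ∈ U, Summable fun k => a k x • u k x) ∧
      ContMDiffOn (𝓡 n) 𝓘(ℝ, H) ∞ (fun x => ∑' k, a k x • u k x) U := by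
  set e := chartAt (EuclideanSpace ℝ (Fin n)) x₀ with he
  obtain ⟨ε, hε, hball⟩ := Metric.isOpen_iff.1 e.open_target _ (mem_chart_target _ x₀)
  let φ : ContDiffBump (e x₀) := ⟨ε / 4, ε / 2, by positivity, by linarith⟩
  have hφ : tsupport φ ⊆ e.target := by
    rw [φ.tsupport_eq]
    exact (Metric.closedBall_subset_ball (by simp only [φ]; linarith)).trans hball
  let w : ℕ → EuclideanSpace ℝ (Fin n) → H := fun k y => φ y • u k (e.symm y)
  have hts : ∀ k, tsupport (w k) ⊆ tsupport φ := fun k =>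
    closure_mono (Function.support_smul_subset_left _ _)
  have hw : ∀ k, ContDiff ℝ ∞ (w k) := by
    intro k
    rw [← contMDiff_iff_contDiff]
    refine contMDiff_of_tsupport fun y hy => ?_
    have hy' : y ∈ e.target := hφ (hts k hy)
    have h1 : ContMDiffAt (𝓡 n) (𝓡 n) ∞ e.symm y :=
      contMDiffOn_chart_symm.contMDiffAt (e.open_target.mem_nhds hy')
    exact φ.contDiff.contMDiff.contMDiffAt.smul ((hu k).contMDiffAt.comp y h1)
  have hcs : ∀ k, HasCompactSupport (w k) := fun k =>
    φ.hasCompactSupport.of_isClosed_subset (isClosed_tsupport _) (hts k)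
  obtain ⟨r, hr0, hrs, hr⟩ := exists_pos_contDiff_tsum_smul w hw hcs
  have hU : ∀ x ∈ e.source ∩ e ⁻¹' (Metric.ball (e x₀) (ε / 2)), ∀ k,
      (r k * φ (e x)) • u k x = r k • w k (e x) := by
    rintro x ⟨hx, -⟩ k
    simp only [w, e.left_inv hx, mul_smul]
  refine ⟨e.source ∩ e ⁻¹' (Metric.ball (e x₀) (ε / 2)),
    (e.isOpen_inter_preimage Metric.isOpen_ball).mem_nhds
      ⟨mem_chart_source _ x₀, Metric.mem_ball_self (by positivity)⟩,
    fun k x => r k * φ (e x), fun k x hx => mul_pos (hr0 k) (φ.pos_of_mem_ball hx.2),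
    fun x hx => ?_, ?_⟩
  · simpa only [hU x hx] using hrs (e x)
  · refine ContMDiffOn.congr (f := fun x => ∑' k, r k • w k (e x)) ?_
      fun x hx => by simp only [hU x hx]
    exact hr.contMDiff.comp_contMDiffOn (contMDiffOn_chart.mono Set.inter_subset_left)

/-- Let `K q ⊆ ℝ × H` be closed convex cones, and suppose that for each point `p` of a set `S` a
smooth function with values in the cones has positive first component at `p`. Then one such function
has positive first component on all of `S`. No condition is imposed on how the cones vary with `q`,
and `S` need not be closed or open. -/
theorem exists_contMDiff_mem_cone_forall_pos [T2Space M]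
    [SecondCountableTopology M] {H : Type*} [NormedAddCommGroup H] [NormedSpace ℝ H]
    [CompleteSpace H] (K : M → ConvexCone ℝ (ℝ × H)) (hK : ∀ q, IsClosed (K q : Set (ℝ × H)))
    (hK0 : ∀ q, (0 : ℝ × H) ∈ K q) (hKn : ∀ q, ∀ z ∈ K q, 0 ≤ z.1) (S : Set M)
    (hS : ∀ p ∈ S, ∃ u : M → ℝ × H, ContMDiff (𝓡 n) 𝓘(ℝ, ℝ × H) ∞ u ∧ (∀ q, u q ∈ K q) ∧
      0 < (u p).1) :
    ∃ u : M → ℝ × H, ContMDiff (𝓡 n) 𝓘(ℝ, ℝ × H) ∞ u ∧ (∀ q, u q ∈ K q) ∧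
      ∀ p ∈ S, 0 < (u p).1 := by
  have := Manifold.locallyCompact_of_finiteDimensional (M := M) (𝓡 n)
  -- Countably many of the given functions suffice; the zero function fills up the enumeration.
  obtain ⟨u, hu, huK, huS⟩ : ∃ u : ℕ → M → ℝ × H, (∀ k, ContMDiff (𝓡 n) 𝓘(ℝ, ℝ × H) ∞ (u k)) ∧
      (∀ k q, u k q ∈ K q) ∧ ∀ p ∈ S, ∃ k, 0 < (u k p).1 := by
    rcases S.eq_empty_or_nonempty with rfl | ⟨p₀, hp₀⟩
    · exact ⟨fun _ _ => 0, fun _ => contMDiff_const, fun _ q => hK0 q, by simp⟩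
    choose! v hv hvK hvS using hS
    obtain ⟨T, hTS, hTc, hT⟩ := TopologicalSpace.countable_cover_nhdsWithin
      (f := fun p => {q | 0 < (v p q).1}) (s := S) fun p hp => mem_nhdsWithin_of_mem_nhds
        ((isOpen_lt continuous_const (continuous_fst.comp (hv p hp).continuous)).mem_nhds (hvS p hp))
    have hTne : T.Nonempty := by
      obtain ⟨t, ht, -⟩ := Set.mem_iUnion₂.1 (hT hp₀)
      exact ⟨t, ht⟩
    obtain ⟨t, rfl⟩ := hTc.exists_eq_range hTne
    refine ⟨fun k => v (t k), fun k => hv _ (hTS ⟨k, rfl⟩), fun k => hvK _ (hTS ⟨k, rfl⟩),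
      fun p hp => ?_⟩
    obtain ⟨_, ⟨k, rfl⟩, hk⟩ := Set.mem_iUnion₂.1 (hT hp)
    exact ⟨k, hk⟩
  suffices h : ∃ g : C^∞⟮𝓡 n, M; 𝓘(ℝ, ℝ × H), ℝ × H⟯,
      ∀ q, g q ∈ {z : ℝ × H | z ∈ K q ∧ (q ∈ S → 0 < z.1)} by
    obtain ⟨g, hg⟩ := h
    exact ⟨g, g.contMDiff, fun q => (hg q).1, fun p hp => (hg p).2 hp⟩
  refine exists_contMDiffMap_forall_mem_convex_of_local (𝓡 n) (n := ⊤) (fun q => ?_) fun x => ?_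
  · intro z hz z' hz' a b ha hb hab
    refine ⟨(K q).convex hz.1 hz'.1 ha hb hab, fun hq => ?_⟩
    have h1 := hz.2 hq
    have h2 := hz'.2 hq
    rcases ha.eq_or_lt with rfl | ha
    · obtain rfl : b = 1 := by simpa using hab
      simpa using h2
    · have : 0 < a * z.1 + b * z'.1 := by positivity
      simpa using this
  · obtain ⟨U, hU, a, ha, hs, hcd⟩ := exists_contMDiffOn_tsum_smul u hu x
    refine ⟨U, hU, _, hcd, fun y hy => ?_⟩
    have hmem : ∀ k, a k y • u k y ∈ K y := fun k => (K y).smul_mem (ha k y hy) (huK k y)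
    refine ⟨?_, fun hyS => ?_⟩
    · refine (hK y).mem_of_tendsto (hs y hy).hasSum (Filter.Eventually.of_forall fun s => ?_)
      induction s using Finset.cons_induction with
      | empty => simpa using hK0 y
      | cons k s hk ih =>
        rw [Finset.sum_cons]
        exact (K y).add_mem (hmem k) ih
    · obtain ⟨k, hk⟩ := huS y hyS
      have h1 : HasSum (fun k => (a k y • u k y).1) (∑' k, a k y • u k y).1 :=
        (hs y hy).hasSum.map (AddMonoidHom.fst ℝ H) continuous_fst
      have h2 := h1.tsum_eq
      rw [← h2]
      exact h1.summable.tsum_pos (fun k => hKn y _ (hmem k)) k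
        (by simpa using mul_pos (ha k y hy) hk)

end SmoothSeries

/-! ### Sections of a generalized subbundle -/

section LocalGenerators

variable {n : ℕ} {M : Type*} [TopologicalSpace M] [ChartedSpace (EuclideanSpace ℝ (Fin n)) M]
  [IsManifold (𝓡 n) ∞ M]
  {F : Type*} [NormedAddCommGroup F] [NormedSpace ℝ F]
  {E : M → Type*} [TopologicalSpace (Bundle.TotalSpace F E)]
  [∀ p, AddCommGroup (E p)] [∀ p, Module ℝ (E p)] [∀ p, TopologicalSpace (E p)]
  [FiberBundle F E]

/-- At each point `p`, smooth functions with values in `Φ G`, defined on all of `M`, form a basis of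
`Φ (G p)`: local sections of `G` are composed with `Φ` and cut off near `p`. -/
theorem GeneralizedSubbundle.IsSmooth.exists_linearIndependent {W : Type*} [NormedAddCommGroup W]
    [NormedSpace ℝ W] [T2Space M]
    {G : GeneralizedSubbundle E} (hG : G.IsSmooth n F) {Φ : ∀ p, E p →ₗ[ℝ] W}
    (hΦ : IsSmoothBundleMap n F Φ) (hinj : ∀ p, Function.Injective (Φ p)) (p : M) :
    ∃ y : M → Fin (Module.finrank ℝ (G p)) → W,
      ContMDiff (𝓡 n) 𝓘(ℝ, Fin (Module.finrank ℝ (G p)) → W) ∞ y ∧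
      (∀ q k, y q k ∈ (G q).map (Φ q)) ∧ LinearIndependent ℝ (y p) := by
  obtain ⟨k, U, σ, hσ, hspan⟩ := hG p
  have : Module.Finite ℝ (Submodule.span ℝ (Set.range fun i => σ i p)) :=
    Module.Finite.span_of_finite ℝ (Set.finite_range _)
  rw [hspan]
  obtain ⟨f, hf, -, hli⟩ := Submodule.exists_fun_fin_finrank_span_eq ℝ
    (Set.range fun i => σ i p)
  choose idx hidx using hf
  obtain ⟨ψ, hψ⟩ := (SmoothBumpFunction.nhds_basis_tsupport (I := 𝓡 n) p).mem_iff.1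
    (Filter.iInter_mem.2 fun i => (hσ i).1.mem_nhds (hσ i).2.1)
  have hψU : ∀ i, tsupport ψ ⊆ U i := fun i => hψ.2.trans (Set.iInter_subset _ i)
  refine ⟨fun q l => ψ q • Φ q (σ (idx l) q), contMDiff_pi_space.2 fun l => ?_, fun q l => ?_, ?_⟩
  · refine contMDiff_of_tsupport fun q hq => ?_
    have hq' : q ∈ U (idx l) :=
      hψU _ (closure_mono (Function.support_smul_subset_left _ _) hq)
    exact ψ.contMDiffAt.smul (hΦ.contMDiffAt.comp q
      ((hσ (idx l)).2.2.1.contMDiffAt ((hσ (idx l)).1.mem_nhds hq')))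
  · by_cases hq : ψ q = 0
    · simp [hq]
    · exact Submodule.smul_mem _ _ (Submodule.mem_map_of_mem
        ((hσ (idx l)).2.2.2 q (hψU _ (subset_closure hq))))
  · have h1 : (fun l => ψ p • Φ p (σ (idx l) p)) = Φ p ∘ f := by
      ext l
      simp [← hidx l]
    change LinearIndependent ℝ fun l => ψ p • Φ p (σ (idx l) p)
    rw [h1]
    exact hli.map' (Φ p) (LinearMap.ker_eq_bot.2 (hinj p))

end LocalGenerators

section Generators

variable {n : ℕ} {M : Type*} [TopologicalSpace M] [ChartedSpace (EuclideanSpace ℝ (Fin n)) M]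
  {F : Type*} [NormedAddCommGroup F] [NormedSpace ℝ F] [FiniteDimensional ℝ F]
  {E : M → Type*} [TopologicalSpace (Bundle.TotalSpace F E)]
  [∀ p, AddCommGroup (E p)] [∀ p, Module ℝ (E p)] [∀ p, TopologicalSpace (E p)]
  [FiberBundle F E] [VectorBundle ℝ F E] [ContMDiffVectorBundle ∞ F E (𝓡 n)]
  {W : Type*} [NormedAddCommGroup W] [InnerProductSpace ℝ W] [FiniteDimensional ℝ W]

/-- If a smooth bundle map `Φ` to a trivial bundle is fiberwise injective, then a section `s` is
smooth as soon as `Φ ∘ s` is: the coefficients of `s` in a local frame are obtained from `Φ ∘ s` and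
the images of the frame by Cramer's rule. -/
theorem IsSmoothBundleMap.isSmoothSectionOn_of_contMDiff {Φ : ∀ p, E p →ₗ[ℝ] W}
    (hΦ : IsSmoothBundleMap n F Φ) (hinj : ∀ p, Function.Injective (Φ p)) {s : ∀ p, E p}
    (hs : ContMDiff (𝓡 n) 𝓘(ℝ, W) ∞ fun p => Φ p (s p)) : IsSmoothSectionOn n F s Set.univ := by
  rw [IsSmoothSectionOn, contMDiffOn_univ]
  intro p
  let e := trivializationAt F E p
  let b := Module.finBasis ℝ F
  have hp : p ∈ e.baseSet := FiberBundle.mem_baseSet_trivializationAt' p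
  have hf := e.isLocalFrameOn_localFrame_baseSet (𝓡 n) ∞ b
  let y : M → Fin (Module.finrank ℝ F) → W := fun q k => Φ q (e.localFrame b k q)
  have hy : ContMDiffAt (𝓡 n) 𝓘(ℝ, Fin (Module.finrank ℝ F) → W) ∞ y p :=
    contMDiffAt_pi_space.2 fun k =>
      hΦ.contMDiffAt.comp p (hf.contMDiffAt e.open_baseSet hp k)
  have hdet : ∀ q ∈ e.baseSet, (Matrix.gram ℝ (y q)).det ≠ 0 := fun q hq =>
    Matrix.det_gram_ne_zero_iff_linearIndependent.2
      ((hf.linearIndependent hq).map' (Φ q) (LinearMap.ker_eq_bot.2 (hinj q)))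
  have hD : ContMDiffAt (𝓡 n) 𝓘(ℝ, ℝ) ∞ (fun q => ((Matrix.gram ℝ (y q)).det)⁻¹) p :=
    (contDiff_det_gram.contMDiff.contMDiffAt.comp p hy).inv₀ (hdet p hp)
  have hc : ∀ k, ContMDiffAt (𝓡 n) 𝓘(ℝ, ℝ) ∞ (fun q => gramCramer (y q) (Φ q (s q)) k) p :=
    fun k => (contDiff_gramCramer k).contMDiff.contMDiffAt.comp p (hy.prodMk_space hs.contMDiffAt)
  have hsum : ContMDiffAt (𝓡 n) ((𝓡 n).prod 𝓘(ℝ, F)) ∞ (fun q => Bundle.TotalSpace.mk' F q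
      (∑ k, (((Matrix.gram ℝ (y q)).det)⁻¹ * gramCramer (y q) (Φ q (s q)) k) •
        e.localFrame b k q)) p :=
    ContMDiffAt.sum_section fun k _ =>
      (hD.mul (hc k)).smul_section (hf.contMDiffAt e.open_baseSet hp k)
  refine hsum.congr_of_eventuallyEq ?_
  filter_upwards [e.open_baseSet.mem_nhds hp] with q hq
  congr 1
  apply hinj q
  have hmem : Φ q (s q) ∈ Submodule.span ℝ (Set.range (y q)) := by
    have : Set.range (y q) = Φ q '' Set.range fun k => e.localFrame b k q := by
      rw [← Set.range_comp]; rfl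
    rw [this, Submodule.span_image]
    exact Submodule.mem_map_of_mem (hf.generating hq trivial)
  have h := sum_gramCramer_smul (y q) (Φ q (s q))
  rw [Submodule.starProjection_eq_self_iff.2 hmem] at h
  simp only [map_sum, map_smul, mul_smul]
  rw [← Finset.smul_sum]
  exact (inv_smul_eq_iff₀ (hdet q hq)).2 h |>.symm

variable [IsManifold (𝓡 n) ∞ M]

/-- The cone of pairs `(c, a)` with `c ≥ 0` such that the vectors `a i` belong to `V` and, if `P`
holds, are `c` times the orthogonal projections of the given vectors `z i` to `V`. -/
def projectionCone {ι W : Type*} [NormedAddCommGroup W] [InnerProductSpace ℝ W]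
    [FiniteDimensional ℝ W] (z : ι → W) (V : Submodule ℝ W) (P : Prop) :
    ConvexCone ℝ (ℝ × (ι → W)) where
  carrier := {x | 0 ≤ x.1 ∧ (∀ i, x.2 i ∈ V) ∧ (P → ∀ i, x.2 i = x.1 • V.starProjection (z i))}
  smul_mem' c hc x hx := ⟨mul_nonneg hc.le hx.1, fun i => V.smul_mem c (hx.2.1 i), fun hP i => by
    simp [hx.2.2 hP i, mul_smul]⟩
  add_mem' x hx y hy := ⟨add_nonneg hx.1 hy.1, fun i => V.add_mem (hx.2.1 i) (hy.2.1 i),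
    fun hP i => by simp [hx.2.2 hP i, hy.2.2 hP i, add_smul]⟩

theorem isClosed_projectionCone {ι W : Type*} [NormedAddCommGroup W] [InnerProductSpace ℝ W]
    [FiniteDimensional ℝ W] (z : ι → W) (V : Submodule ℝ W) (P : Prop) :
    IsClosed (projectionCone z V P : Set (ℝ × (ι → W))) := by
  have h (i : ι) : Continuous fun x : ℝ × (ι → W) => x.2 i :=
    (continuous_apply i).comp continuous_snd
  change IsClosed {x : ℝ × (ι → W) | 0 ≤ x.1 ∧ (∀ i, x.2 i ∈ V) ∧
    (P → ∀ i, x.2 i = x.1 • V.starProjection (z i))}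
  simp only [Set.ofPred_and, Set.ofPred_forall]
  refine (isClosed_le continuous_const continuous_fst).inter (IsClosed.inter ?_ ?_)
  · exact isClosed_iInter fun i => V.closed_of_finiteDimensional.preimage (h i)
  · exact isClosed_iInter fun _ => isClosed_iInter fun i =>
      isClosed_eq (h i) (continuous_fst.smul continuous_const)

/-- On the stratum where `G` has dimension `d`, the orthogonal projections of a spanning family of
`W` to the fibers of `Φ G` span these fibers. They depend smoothly on the point only within the
stratum, but locally some smooth multiple of them extends to a section of `Φ G`: the projections to
the span of `d` sections, multiplied by their Gram determinant, which vanishes at the points of the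
stratum where they do not span `Φ G`. -/
theorem GeneralizedSubbundle.IsSmooth.exists_sections_span_stratum [T2Space M]
    [SecondCountableTopology M] {G : GeneralizedSubbundle E} (hG : G.IsSmooth n F)
    {Φ : ∀ p, E p →ₗ[ℝ] W} (hΦ : IsSmoothBundleMap n F Φ) (hinj : ∀ p, Function.Injective (Φ p))
    {ι : Type*} [Fintype ι] (z : ι → W) (hz : Submodule.span ℝ (Set.range z) = ⊤) (d : ℕ) :
    ∃ s : ι → ∀ p, E p, (∀ i, G.IsSectionOn n F (s i) Set.univ) ∧
      ∀ p ∈ G.stratum d, G p = Submodule.span ℝ (Set.range fun i => s i p) := by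
  obtain ⟨u, hu, huK, hupos⟩ := exists_contMDiff_mem_cone_forall_pos (n := n)
    (fun q => projectionCone z ((G q).map (Φ q)) (q ∈ G.stratum d))
    (fun q => isClosed_projectionCone _ _ _) (fun q => ⟨le_rfl, by simp, by simp⟩)
    (fun q x hx => hx.1) (G.stratum d) (fun p hp => by
      obtain ⟨y, hy, hyG, hyp⟩ := hG.exists_linearIndependent hΦ hinj p
      have hpd : Module.finrank ℝ (G p) = d := hp
      refine ⟨fun q => ((Matrix.gram ℝ (y q)).det,
        fun i => ∑ k, gramCramer (y q) (z i) k • y q k), ?_, fun q => ?_, ?_⟩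
      · have h : ContDiff ℝ ∞ fun y : Fin (Module.finrank ℝ (G p)) → W =>
            ((Matrix.gram ℝ y).det, fun i => ∑ k, gramCramer y (z i) k • y k) :=
          contDiff_det_gram.prodMk (contDiff_pi.2 fun i => ContDiff.sum fun k _ =>
            ((contDiff_gramCramer k).comp (contDiff_id.prodMk contDiff_const)).smul
              (contDiff_apply ℝ W k))
        exact h.contMDiff.comp hy
      · refine ⟨(Matrix.posSemidef_gram ℝ (y q)).det_nonneg, fun i => ?_, fun hq i => ?_⟩
        · change ∑ k, gramCramer (y q) (z i) k • y q k ∈ (G q).map (Φ q)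
          exact Submodule.sum_mem _ fun k _ => Submodule.smul_mem _ _ (hyG q k)
        dsimp only
        rw [sum_gramCramer_smul]
        by_cases hdet : (Matrix.gram ℝ (y q)).det = 0
        · simp [hdet]
        · have hli := Matrix.det_gram_ne_zero_iff_linearIndependent.1 hdet
          have hqd : Module.finrank ℝ (G q) = d := hq
          have hspan : Submodule.span ℝ (Set.range (y q)) = (G q).map (Φ q) := by
            refine Submodule.eq_of_le_of_finrank_eq (Submodule.span_le.2 ?_) ?_
            · rintro _ ⟨k, rfl⟩
              exact hyG q k
            · rw [finrank_span_eq_card hli, Fintype.card_fin,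
                ← (Submodule.equivMapOfInjective _ (hinj q) (G q)).finrank_eq, hpd, hqd]
          simp only [hspan]
      · exact (Matrix.posSemidef_gram ℝ (y p)).det_nonneg.lt_of_ne'
          (Matrix.det_gram_ne_zero_iff_linearIndependent.2 hyp))
  choose s hsG hs using fun i q => (huK q).2.1 i
  have hsmooth : ∀ i, IsSmoothSectionOn n F (s i) Set.univ := fun i =>
    hΦ.isSmoothSectionOn_of_contMDiff hinj (by
      simp only [hs]
      exact contMDiff_pi_space.1 (contDiff_snd.contMDiff.comp hu) i)
  refine ⟨s, fun i => ⟨hsmooth i, fun q _ => hsG i q⟩, fun p hp => ?_⟩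
  apply Submodule.map_injective_of_injective (hinj p)
  rw [Submodule.map_span, ← Set.range_comp]
  set V := (G p).map (Φ p)
  have h1 : (Φ p ∘ fun i => s i p) = fun i => (u p).1 • V.starProjection (z i) := by
    ext1 i
    rw [Function.comp_apply, hs, (huK p).2.2 hp i]
  have h2 : Set.range (fun i => (u p).1 • V.starProjection (z i)) =
      ((u p).1 • V.starProjection).toLinearMap '' Set.range z := by
    rw [← Set.range_comp]
    rfl
  rw [h1, h2, Submodule.span_image, hz, Submodule.map_top]
  have h3 := (hupos p hp).ne'
  rw [ContinuousLinearMap.toLinearMap_smul, LinearMap.range_smul _ _ h3]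
  exact (Submodule.range_starProjection V).symm

/-- If `E` embeds in `M × W` and `z` is a spanning family of `W`, then `G` is generated by one
section for each member of `z` and each positive dimension of the fibers of `G`. -/
theorem GeneralizedSubbundle.IsSmooth.exists_generatesOver_univ [T2Space M]
    [SecondCountableTopology M] {G : GeneralizedSubbundle E} (hG : G.IsSmooth n F)
    {Φ : ∀ p, E p →ₗ[ℝ] W} (hΦ : IsSmoothBundleMap n F Φ) (hinj : ∀ p, Function.Injective (Φ p))
    {ι : Type*} [Fintype ι] (z : ι → W) (hz : Submodule.span ℝ (Set.range z) = ⊤) :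
    ∃ s : Fin G.maxdim × ι → ∀ p, E p, G.GeneratesOver n F s Set.univ ∧
      ∀ (d : Fin G.maxdim), ∀ p ∈ G.stratum (d + 1),
        G p = Submodule.span ℝ (Set.range fun i => s (d, i) p) := by
  choose s hsG hs using hG.exists_sections_span_stratum hΦ hinj z hz
  refine ⟨fun x => s (x.1 + 1) x.2, ⟨fun x => hsG _ _, fun p _ => le_antisymm ?_ ?_⟩,
    fun d p hp => hs _ p hp⟩
  · have hfin : Module.Finite ℝ (E p) := Module.Finite.of_injective (Φ p) (hinj p)
    rcases Nat.eq_zero_or_pos (Module.finrank ℝ (G p)) with h0 | h0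
    · rw [Submodule.finrank_eq_zero.1 h0]
      exact bot_le
    · have hbdd : BddAbove (Set.range fun q => Module.finrank ℝ (G q)) := by
        refine ⟨Module.finrank ℝ W, ?_⟩
        rintro _ ⟨q, rfl⟩
        exact LinearMap.finrank_le_finrank_of_injective (f := (Φ q).domRestrict (G q))
          ((hinj q).comp Subtype.val_injective)
      have hle : Module.finrank ℝ (G p) ≤ G.maxdim := le_ciSup hbdd p
      have hp : p ∈ G.stratum (Module.finrank ℝ (G p) - 1 + 1) := by
        change Module.finrank ℝ (G p) = _
        omega
      refine (hs _ p hp).le.trans (Submodule.span_mono ?_)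
      rintro _ ⟨i, rfl⟩
      exact ⟨(⟨Module.finrank ℝ (G p) - 1, by omega⟩, i), rfl⟩
  · rw [Submodule.span_le]
    rintro _ ⟨x, rfl⟩
    exact (hsG _ _).2 p trivial

end Generators

theorem theorem2 {n : ℕ} {M : Type*} [TopologicalSpace M] [T2Space M] [SecondCountableTopology M]
    [ConnectedSpace M] [ChartedSpace (EuclideanSpace ℝ (Fin n)) M] [IsManifold (𝓡 n) ∞ M]
    {F : Type*} [NormedAddCommGroup F] [NormedSpace ℝ F] [FiniteDimensional ℝ F]
    {E : M → Type*} [TopologicalSpace (Bundle.TotalSpace F E)]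
    [∀ p, AddCommGroup (E p)] [∀ p, Module ℝ (E p)] [∀ p, TopologicalSpace (E p)]
    [FiberBundle F E] [VectorBundle ℝ F E] [ContMDiffVectorBundle ∞ F E (𝓡 n)]
    (G : GeneralizedSubbundle E) (hG : G.IsSmooth n F) :
    G.GloballyFinitelyGenerated n F ∧
    (∃ m : ℕ, m ≤ Module.finrank ℝ F * (n + 1) ∧ EmbedsInTrivialBundle n F E m) ∧
    ∀ m : ℕ, EmbedsInTrivialBundle n F E m →
      ∃ s : Fin G.maxdim × Fin m → ∀ p, E p,
        G.GeneratesOver n F s Set.univ ∧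
        ∀ (d : Fin G.maxdim), ∀ p ∈ G.stratum (d + 1),
          G p = Submodule.span ℝ (Set.range fun i : Fin m => s (d, i) p) := by
  have hgen : ∀ m : ℕ, EmbedsInTrivialBundle n F E m →
      ∃ s : Fin G.maxdim × Fin m → ∀ p, E p,
        G.GeneratesOver n F s Set.univ ∧
        ∀ (d : Fin G.maxdim), ∀ p ∈ G.stratum (d + 1),
          G p = Submodule.span ℝ (Set.range fun i : Fin m => s (d, i) p) := by
    rintro m ⟨Φ, hinj, hΦ⟩
    refine hG.exists_generatesOver_univ hΦ.snd hinj (EuclideanSpace.basisFun (Fin m) ℝ) ?_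
    rw [← OrthonormalBasis.coe_toBasis]
    exact Module.Basis.span_eq _
  have hemb : EmbedsInTrivialBundle n F E (Module.finrank ℝ F * (n + 1)) := by
    obtain ⟨Φ, hΦ, hinj⟩ := exists_isSmoothBundleMap_injective (n := n) (F := F) (E := E)
      (W := EuclideanSpace ℝ (Fin (Module.finrank ℝ F * (n + 1)))) (fun hpos => by
        rw [finrank_euclideanSpace_fin]
        nlinarith)
    exact ⟨Φ, hinj, (Bundle.contMDiff_proj E).prodMk hΦ⟩
  refine ⟨?_, ⟨_, le_rfl, hemb⟩, hgen⟩
  obtain ⟨s, ⟨hs, hspan⟩, -⟩ := hgen _ hemb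
  let φ := finProdFinEquiv (m := G.maxdim) (n := Module.finrank ℝ F * (n + 1))
  refine ⟨_, fun i => s (φ.symm i), fun i => hs _, fun p hp => (hspan p hp).trans ?_⟩
  rw [← φ.symm.surjective.range_comp]
  rfl
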